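/- Colored tensor graphs. A rank $4$ half-edged colored tensor graph is a finite bipartite graph in which each vertex carries, for each color $i\in\{0,\dots,4\}$, exactly one edge or one half-edge of color $i$. It is regarded as a stranded graph. Each vertex has one pre-edge of each color, where its edge or half-edge is attached. The pre-edge of color $i$ has four points, one for each color $j\neq i$. The pre-edges of colors $i\ne j$ at a vertex are joined by one chord, which carries the pair of colors $\{i,j\}$. The strands of an edge of color $i$ join the points with equal labels $j$ of its two pre-edges and carry the pairs $\{i,j\}$. Contraction. Contracting an edge deletes it together with its two pre-edges. Each strand of the edge that is closed by a single chord becomes a trivial disc vertex (a single closed chord). Each other strand merges with the two chords at its ends into one chord. The vertices other than discs are the connected components of the pre-edges under the chords. A representative $\mathcal G$ of a rank $4$ w-colored graph is a stranded graph which, up to addition or removal of trivial disc vertices, is obtained from a rank $4$ half-edged colored tensor graph by successively contracting finitely many (possibly zero) edges. Let - $V$ be the number of its vertices (trivial discs included) and $E$ the number of its edges (half-edges are not counted); - $F_{\rm int}$ be the number of its internal faces, i.e. closed curves made of chords and strands that meet no half-edge (the closed chord of a trivial disc is one of them); - $B^k$ $(k=3,4)$ be the number of its $k$-bubbles (open or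 closed): for each set $S$ of $k$ colors, the connected components of the structure consisting of the pre-edges and edges with color in $S$ and the chords and strands with both colors in $S$ (trivial discs are not bubbles). Proposition. Let $\mathcal G$ be any representative of a rank $4$ w-colored graph which has at least one vertex that is not a trivial disc. Then there exist positive rational numbers $\alpha_3,\alpha_4$ such that $$\gamma_{4;(\alpha_3,\alpha_4)}(\mathcal G)=6(V-E)+3F_{\rm int}-2(1+\alpha_3)B^3+(3\alpha_3-\alpha_4)B^4$$ is a (strictly) negative integer. Moreover, if $\mathcal G$ has no trivial disc vertices, then this holds for all positive rational numbers $\alpha_3,\alpha_4$ for which $-2(1+\alpha_3)B^3+(3\alpha_3-\alpha_4)B^4$ is an integer. -/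

import Mathlib

/-- The end points of the chords (equivalently, of the strands) when the pre-edges form the type `P`
and are colored by `{0, …, D}`: a pre-edge `p` of color `i` carries exactly `D` points, one for
each color `j ≠ i`. The point `(p, j)` lies on the strand with the pair of colors `{i, j}`. -/
abbrev StrandEnd {D : ℕ} {P : Type*} (color : P → Fin (D + 1)) : Type _ :=
  {x : P × Fin (D + 1) // x.2 ≠ color x.1}

/-- Rank `D` half-edged stranded graphs with the color decoration which they inherit from colored
tensor graphs, given combinatorially (up to homeomorphisms of chords and strands, changes of
crossings, permutations of the points inside a pre-edge and moves of the pre-edges on the frontier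
of a vertex).

* `P` is the set of non-empty pre-edges; each has a color and `D` points (see `StrandEnd`).
* `chord` pairs the points by the chords of the stranded vertices; a chord joins two points with
  the same pair of colors.
* `edge p` is the pre-edge at the other end of the edge attached to `p`; `edge p = p` means that `p`
  carries a stranded half-edge instead. The strands of an edge are parallel: they join `(p, j)`
  to `(edge p, j)`.
* `discs` is the number of trivial disc vertices (a single closed chord each).

The stranded vertices other than discs are the connected components of the chord diagram. -/
structure StrandedGraph (D : ℕ) where
  P : Type
  [finite : Finite P]
  color : P → Fin (D + 1)
  chord : StrandEnd color → StrandEnd color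
  chord_chord : ∀ x, chord (chord x) = x
  chord_ne : ∀ x, chord x ≠ x
  chord_pair : ∀ x, s(color (chord x).1.1, (chord x).1.2) = s(color x.1.1, x.1.2)
  edge : P → P
  edge_edge : ∀ p, edge (edge p) = p
  edge_color : ∀ p, color (edge p) = color p
  discs : ℕ

namespace StrandedGraph

attribute [instance] StrandedGraph.finite

variable {D : ℕ} (G : StrandedGraph D)

/-- The other end of the strand, inside the edge attached to `x.1.1`, that starts at the point `x`
(the point itself on a half-edge). -/
def strand (x : StrandEnd G.color) : StrandEnd G.color :=
  ⟨(G.edge x.1.1, x.1.2), by rw [G.edge_color]; exact x.2⟩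

/-! ### Counting vertices, edges, internal faces and bubbles -/

/-- Two pre-edges are joined by a chord. -/
def ChordAdj (p q : G.P) : Prop :=
  ∃ x : StrandEnd G.color, x.1.1 = p ∧ (G.chord x).1.1 = q

/-- The stranded vertices that are not trivial discs: connected components of the pre-edges under
the chords. -/
def NontrivialVertex : Type := Quot G.ChordAdj

/-- `V`: all stranded vertices, the trivial discs included. -/
noncomputable def numVertices : ℕ := Nat.card G.NontrivialVertex + G.discs

/-- `E`: the edges (half-edges are not counted). -/
noncomputable def numEdges : ℕ :=
  Set.ncard {z : Sym2 G.P | ∃ p, G.edge p ≠ p ∧ z = s(p, G.edge p)}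

/-- Consecutive points on a face: joined by a chord of a vertex or by a strand of an edge. -/
def FaceAdj (x y : StrandEnd G.color) : Prop := y = G.chord x ∨ y = G.strand x

/-- The faces (open or closed) which pass through at least one pre-edge. -/
def Face : Type := Quot G.FaceAdj

/-- A face is closed (internal) if it does not pass through a half-edge. -/
def IsClosedFace (f : G.Face) : Prop :=
  ∀ x : StrandEnd G.color, Quot.mk G.FaceAdj x = f → G.edge x.1.1 ≠ x.1.1

/-- `F_int`: the internal faces; the closed chord of a trivial disc is an internal face. -/
noncomputable def numInternalFaces : ℕ := Nat.card {f : G.Face // G.IsClosedFace f} + G.discs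

/-- Adjacency in the part of the graph made only of the strands whose two colors are in `S`:
two pre-edges with colors in `S` are joined by an edge, or by a chord with both colors in `S`. -/
def BubbleAdj (S : Finset (Fin (D + 1))) (p q : {p : G.P // G.color p ∈ S}) : Prop :=
  q.1 = G.edge p.1 ∨
    ∃ x : StrandEnd G.color, x.1.2 ∈ S ∧ x.1.1 = p.1 ∧ (G.chord x).1.1 = q.1

/-- The bubbles (open or closed) with set of colors `S`. -/
def Bubble (S : Finset (Fin (D + 1))) : Type := Quot (G.BubbleAdj S)

/-- `B^k`: the `k`-bubbles, for `k ≥ 2`. -/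
noncomputable def numBubbles (k : ℕ) : ℕ :=
  ∑ S ∈ (Finset.univ : Finset (Fin (D + 1))).powersetCard k, Nat.card (G.Bubble S)

/-! ### Contraction of an edge -/

/-- The point `x` belongs to one of the two pre-edges of the edge attached to `a`. -/
def OnEdge (a : G.P) (x : StrandEnd G.color) : Prop := x.1.1 = a ∨ x.1.1 = G.edge a

theorem strand_strand (x : StrandEnd G.color) : G.strand (G.strand x) = x := by
  apply Subtype.ext
  simp [strand, G.edge_edge]

theorem onEdge_strand {a : G.P} {x : StrandEnd G.color} (h : G.OnEdge a x) :
    G.OnEdge a (G.strand x) := by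
  rcases h with h | h
  · right; simp [strand, h]
  · left; simp [strand, h, G.edge_edge]

open Classical in
/-- The new chords after contraction of the edge attached to `a`: a chord that ends on a strand of
the edge is connected through this strand to the chord at its other end. -/
noncomputable def newChord (a : G.P) (x : StrandEnd G.color) : StrandEnd G.color :=
  if G.OnEdge a (G.chord x) then G.chord (G.strand (G.chord x)) else G.chord x

theorem chord_inj {x y : StrandEnd G.color} (h : G.chord x = G.chord y) : x = y := by
  rw [← G.chord_chord x, h, G.chord_chord]

theorem onEdge_eq {a : G.P} {x y : StrandEnd G.color} (hx : G.OnEdge a x) (hy : G.OnEdge a y)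
    (h : x.1.2 = y.1.2) : x = y ∨ x = G.strand y := by
  rcases hx with hx | hx <;> rcases hy with hy | hy
  · left; apply Subtype.ext; ext1 <;> simp [hx, hy, h]
  · right; apply Subtype.ext; ext1 <;> simp [strand, hx, hy, h, G.edge_edge]
  · right; apply Subtype.ext; ext1 <;> simp [strand, hx, hy, h]
  · left; apply Subtype.ext; ext1 <;> simp [hx, hy, h]

theorem onEdge_color {a : G.P} {x : StrandEnd G.color} (h : G.OnEdge a x) :
    G.color x.1.1 = G.color a := by
  rcases h with h | h
  · rw [h]
  · rw [h, G.edge_color]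

theorem newChord_not_onEdge {a : G.P} {x : StrandEnd G.color} (hx : ¬ G.OnEdge a x) :
    ¬ G.OnEdge a (G.newChord a x) := by
  unfold newChord
  split_ifs with h
  · intro hz
    have hs := G.onEdge_strand h
    have hp := G.chord_pair (G.strand (G.chord x))
    rw [G.onEdge_color hz, G.onEdge_color hs, Sym2.congr_right] at hp
    rcases G.onEdge_eq hz hs hp with h1 | h1
    · exact G.chord_ne _ h1
    · rw [G.strand_strand] at h1
      have h2 := G.chord_inj h1
      exact hx (h2 ▸ hs)
  · exact h

theorem newChord_newChord {a : G.P} {x : StrandEnd G.color} (hx : ¬ G.OnEdge a x) :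
    G.newChord a (G.newChord a x) = x := by
  by_cases h : G.OnEdge a (G.chord x)
  · have h1 : G.newChord a x = G.chord (G.strand (G.chord x)) := if_pos h
    rw [h1]
    unfold newChord
    rw [G.chord_chord, if_pos (G.onEdge_strand h), G.strand_strand, G.chord_chord]
  · have h1 : G.newChord a x = G.chord x := if_neg h
    rw [h1]
    unfold newChord
    rw [G.chord_chord, if_neg hx]

theorem newChord_ne {a : G.P} (ha : G.edge a ≠ a) (x : StrandEnd G.color) :
    G.newChord a x ≠ x := by
  unfold newChord
  split_ifs with h
  · intro h1
    have h2 : G.strand (G.chord x) = G.chord x := by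
      apply G.chord_inj; rw [h1, G.chord_chord]
    have h3 : G.edge (G.chord x).1.1 = (G.chord x).1.1 := congrArg (fun y => y.1.1) h2
    rcases h with h | h
    · rw [h] at h3; exact ha h3
    · rw [h, G.edge_edge] at h3; exact ha h3.symm
  · exact G.chord_ne x

theorem newChord_pair (a : G.P) (x : StrandEnd G.color) :
    s(G.color (G.newChord a x).1.1, (G.newChord a x).1.2) = s(G.color x.1.1, x.1.2) := by
  unfold newChord
  split_ifs with h
  · rw [G.chord_pair, ← G.chord_pair x]
    simp [strand, G.edge_color]
  · exact G.chord_pair x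

/-- The number of inner faces of the edge attached to `a`: the strands that are closed by a chord. -/
noncomputable def numInnerFaces (a : G.P) : ℕ :=
  Nat.card {x : StrandEnd G.color // x.1.1 = a ∧ G.chord x = G.strand x}

/-- The contraction of the edge between `a` and `edge a`. The two pre-edges of the edge disappear,
each inner face of the edge becomes a trivial disc, and the remaining chords are connected through
the outer strands of the edge. -/
noncomputable def contract (a : G.P) (ha : G.edge a ≠ a) : StrandedGraph D where
  P := {p : G.P // ¬ (p = a ∨ p = G.edge a)}
  color p := G.color p.1
  chord x :=
    ⟨(⟨(G.newChord a ⟨(x.1.1.1, x.1.2), x.2⟩).1.1, G.newChord_not_onEdge x.1.1.2⟩,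
      (G.newChord a ⟨(x.1.1.1, x.1.2), x.2⟩).1.2), (G.newChord a ⟨(x.1.1.1, x.1.2), x.2⟩).2⟩
  chord_chord x := by
    have h := G.newChord_newChord (a := a) (x := ⟨(x.1.1.1, x.1.2), x.2⟩) x.1.1.2
    apply Subtype.ext
    refine Prod.ext (Subtype.ext ?_) ?_
    · exact congrArg (fun y => y.1.1) h
    · exact congrArg (fun y => y.1.2) h
  chord_ne x := by
    intro h
    apply G.newChord_ne ha ⟨(x.1.1.1, x.1.2), x.2⟩
    apply Subtype.ext
    refine Prod.ext ?_ ?_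
    · exact congrArg (fun y => y.1.1.1) h
    · exact congrArg (fun y => y.1.2) h
  chord_pair x := G.newChord_pair a ⟨(x.1.1.1, x.1.2), x.2⟩
  edge p := ⟨G.edge p.1, by
    rintro (h | h)
    · exact p.2 (Or.inr ((G.edge_edge p.1).symm.trans (congrArg G.edge h)))
    · exact p.2 (Or.inl (((G.edge_edge p.1).symm.trans (congrArg G.edge h)).trans (G.edge_edge a)))⟩
  edge_edge p := Subtype.ext (G.edge_edge p.1)
  edge_color p := G.edge_color p.1
  discs := G.discs + G.numInnerFaces a

/-- `H` is obtained from `G` by contracting one edge. -/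
def ContractsTo (G H : StrandedGraph D) : Prop :=
  ∃ (a : G.P) (ha : G.edge a ≠ a), H = G.contract a ha

/-- Equivalence up to trivial discs: the graphs coincide, up to renaming the pre-edges, once all the
trivial discs are removed. -/
def EquivUpToDiscs (G H : StrandedGraph D) : Prop :=
  ∃ (φ : G.P ≃ H.P) (hc : ∀ p, H.color (φ p) = G.color p),
    (∀ p, H.edge (φ p) = φ (G.edge p)) ∧
    ∀ x : StrandEnd G.color,
      (H.chord ⟨(φ x.1.1, x.1.2), by rw [hc]; exact x.2⟩).1 =
        (φ (G.chord x).1.1, (G.chord x).1.2)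

end StrandedGraph

/-- Rank `D` half-edged colored tensor graphs, in compact form: a finite set `V` of vertices split
into two classes by `sign`; each vertex carries for each color `i ∈ {0, …, D}` either one edge of
color `i`, to the vertex `link i v` of the other class, or one half-edge of color `i`, and then
`link i v = v`. -/
structure ColoredTensorGraph (D : ℕ) where
  V : Type
  [finite : Finite V]
  sign : V → Bool
  link : Fin (D + 1) → V → V
  link_link : ∀ i v, link i (link i v) = v
  bipartite : ∀ i v, link i v ≠ v → sign (link i v) ≠ sign v

namespace ColoredTensorGraph

attribute [instance] ColoredTensorGraph.finite

/-- The stranded structure of a colored tensor graph: each vertex has `D + 1` pre-edges, one of each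
color, and the pre-edges of colors `i ≠ j` of a vertex are joined by exactly one chord, so that the
vertex graph is `K_{D+1}`. -/
def toStranded {D : ℕ} (T : ColoredTensorGraph D) : StrandedGraph D where
  P := T.V × Fin (D + 1)
  color p := p.2
  chord x := ⟨((x.1.1.1, x.1.2), x.1.1.2), x.2.symm⟩
  chord_chord _ := rfl
  chord_ne x h := x.2 (congrArg (fun y => y.1.1.2) h)
  chord_pair _ := Sym2.eq_swap
  edge p := (T.link p.2 p.1, p.2)
  edge_edge p := by simp [T.link_link]
  edge_color _ := rfl
  discs := 0

end ColoredTensorGraph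

namespace StrandedGraph

/-- `G` is a representative of a rank `D` w-colored graph: up to trivial discs, it is obtained by
successive edge contractions from some rank `D` half-edged colored tensor graph. -/
def IsWColoredRepresentative {D : ℕ} (G : StrandedGraph D) : Prop :=
  ∃ (T : ColoredTensorGraph D) (H : StrandedGraph D),
    Relation.ReflTransGen ContractsTo T.toStranded H ∧ EquivUpToDiscs G H

/-- `γ_{4;(α₃,α₄)} = 6(V - E) + 3 F_int - 2(1 + α₃) B³ + (3α₃ - α₄) B⁴`. -/
noncomputable def gamma4 (G : StrandedGraph 4) (α₃ α₄ : ℚ) : ℚ :=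
  6 * ((G.numVertices : ℚ) - G.numEdges) + 3 * G.numInternalFaces
    - 2 * (1 + α₃) * G.numBubbles 3 + (3 * α₃ - α₄) * G.numBubbles 4

end StrandedGraph

/-! Without discs, $\gamma$ splits as $(6V-6E+3F_{\rm int}-2B^3)+\alpha_3(3B^4-2B^3)-\alpha_4B^4$.
The first two terms are nonpositive and the last is negative as soon as there is a pre-edge.

The first bound is a sum of Euler inequalities. For a set $S$ of three colors, each pre-edge with
color in $S$ keeps exactly two points, so the strands inside $S$ form a ribbon graph. Its mod 2
chains give $V_S+F_S\le E_S+2C_S$ (`card_vertices_add_card_faces_le`): the coboundary of vertex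
functions and the boundary of closed-face functions are orthogonal in the space of functions on the
edges, and both kernels consist of functions constant on bubbles, hence have dimension at most
$C_S$. Among five colors, a color lies in 6 triples and a pair in 3, which yields $6V+3F\le
6E+2B^3$.

The second bound, $3B^4\le 2B^3$, holds because every 4-bubble contains at least three 3-bubbles,
while a triple of colors lies in only two quadruples.

Each disc adds $6+3=9$ to $\gamma$ and nothing to the bubbles, so with discs present $\alpha_4$ has
to be taken large. -/

/-! ### Linear algebra -/

/-- Two linear maps to `ι → K` whose ranges are orthogonal for the dot product have total rank at
most the cardinality of `ι`. -/
theorem finrank_range_add_finrank_range_le_card {K ι U W : Type*} [Field K] [Fintype ι]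
    [AddCommGroup U] [Module K U] [AddCommGroup W] [Module K W]
    (a : U →ₗ[K] ι → K) (b : W →ₗ[K] ι → K) (h : ∀ u w, ∑ i, a u i * b w i = 0) :
    Module.finrank K (LinearMap.range a) + Module.finrank K (LinearMap.range b) ≤
      Fintype.card ι := by
  classical
  have h1 := Subspace.finrank_add_finrank_dualAnnihilator_eq (LinearMap.range a)
  -- The dot product identifies the range of `b` with functionals that vanish on the range of `a`.
  have h2 : (LinearMap.range b).map (dotProductEquiv K ι).toLinearMap ≤
      (LinearMap.range a).dualAnnihilator := by
    rintro _ ⟨_, ⟨w, rfl⟩, rfl⟩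
    rw [Submodule.mem_dualAnnihilator]
    rintro _ ⟨u, rfl⟩
    have := h u w
    simp only [LinearEquiv.coe_coe, dotProductEquiv_apply_apply, dotProduct]
    rw [← this]
    exact Finset.sum_congr rfl fun i _ => mul_comm _ _
  have h3 := Submodule.finrank_mono h2
  rw [LinearEquiv.finrank_map_eq] at h3
  rw [Module.finrank_fintype_fun_eq_card] at h1
  omega

/-- A space of functions which are constant along a relation has dimension at most the number of
classes. -/
theorem finrank_le_card_quot {K Q W : Type*} [Field K] [Finite Q] [AddCommGroup W] [Module K W]
    (r : Q → Q → Prop) (T : W →ₗ[K] Q → K) (hT : Function.Injective T)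
    (hr : ∀ w p q, r p q → T w p = T w q) :
    Module.finrank K W ≤ Nat.card (Quot r) := by
  classical
  have : Finite (Quot r) := Finite.of_surjective _ Quot.mk_surjective
  have := Fintype.ofFinite (Quot r)
  rw [Nat.card_eq_fintype_card, ← Module.finrank_fintype_fun_eq_card K]
  -- Evaluation at one representative per class is injective, since the functions are constant on
  -- classes.
  refine LinearMap.finrank_le_finrank_of_injective
    (f := (LinearMap.funLeft K K (Quot.out : Quot r → Q)).comp T) ?_
  rw [← LinearMap.ker_eq_bot, LinearMap.ker_eq_bot']
  intro w hw
  apply hT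
  rw [map_zero]
  funext p
  have h1 := congrFun hw (Quot.mk r p)
  simp only [LinearMap.comp_apply, LinearMap.funLeft_apply, Pi.zero_apply] at h1
  have h2 : ∀ c : Quot r, ∀ q, Quot.mk r q = c → T w q = Quot.lift (T w) (hr w) c := by
    rintro _ q rfl; rfl
  rw [h2 _ p rfl]
  exact (h2 (Quot.mk r p) _ (Quot.out_eq _)).symm.trans h1

/-- Sum of a function over the points which are moved by an involution, as a sum over the orbits. -/
theorem sum_eq_sum_subtype_add_of_involutive {P M : Type*} [Fintype P] [AddCommMonoid M]
    {e : P → P} (he : Function.Involutive e) {rk : P → ℕ} (hrk : Function.Injective rk)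
    (c : P → Prop) (hc : ∀ p, c p → c (e p)) [Fintype {p // c p ∧ rk p < rk (e p)}]
    (φ : P → M) (h0 : ∀ p, e p = p → φ p = 0) (h1 : ∀ p, ¬ c p → φ p = 0) :
    ∑ p, φ p = ∑ p : {p // c p ∧ rk p < rk (e p)}, (φ p.1 + φ (e p.1)) := by
  classical
  have hA : ∑ p : {p // c p ∧ rk p < rk (e p)}, (φ p.1 + φ (e p.1)) =
      ∑ p ∈ Finset.univ.filter (fun p => c p ∧ rk p < rk (e p)), (φ p + φ (e p)) :=
    (Finset.sum_subtype _ (by simp) fun p => φ p + φ (e p)).symm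
  have hB : ∑ p ∈ Finset.univ.filter (fun p => c p ∧ rk p < rk (e p)), φ (e p) =
      ∑ p ∈ Finset.univ.filter (fun p => c p ∧ rk (e p) < rk p), φ p := by
    refine Finset.sum_nbij' e e ?_ ?_ ?_ ?_ ?_
    · intro p hp
      simp only [Finset.mem_filter, Finset.mem_univ, true_and, he p] at hp ⊢
      exact ⟨hc _ hp.1, hp.2⟩
    · intro p hp
      simp only [Finset.mem_filter, Finset.mem_univ, true_and, he p] at hp ⊢
      exact ⟨hc _ hp.1, hp.2⟩
    · intro p _; exact he p
    · intro p _; exact he p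
    · intro p _; rfl
  rw [hA, Finset.sum_add_distrib, hB, ← Finset.sum_union]
  · refine (Finset.sum_subset (Finset.subset_univ _) ?_).symm
    intro p _ hp
    simp only [Finset.mem_union, Finset.mem_filter, Finset.mem_univ, true_and, not_or,
      not_and, not_lt] at hp
    by_cases hcp : c p
    · exact h0 p (hrk (le_antisymm (hp.1 hcp) (hp.2 hcp)))
    · exact h1 p hcp
  · rw [Finset.disjoint_filter]
    intro p _ h h'
    exact lt_asymm h.2 h'.2

/-- Double counting of the pairs `(S, a)` with `r S a`. -/
theorem sum_card_subtype_eq_sum_card_filter {α β : Type*} [Fintype α] (s : Finset β)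
    (r : β → α → Prop) [∀ b a, Decidable (r b a)] :
    ∑ b ∈ s, Nat.card {a // r b a} = ∑ a, (s.filter fun b => r b a).card := by
  simp only [Nat.card_eq_fintype_card, Fintype.card_subtype, Finset.card_filter]
  exact Finset.sum_comm

theorem mul_card_le_sum_card_subtype {α β : Type*} [Fintype α] (s : Finset β)
    (r : β → α → Prop) [∀ b a, Decidable (r b a)] (n : ℕ)
    (h : ∀ a, n ≤ (s.filter fun b => r b a).card) :
    n * Nat.card α ≤ ∑ b ∈ s, Nat.card {a // r b a} := by
  rw [sum_card_subtype_eq_sum_card_filter, Nat.card_eq_fintype_card, mul_comm]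
  exact Finset.card_nsmul_le_sum _ _ _ fun a _ => h a

namespace StrandedGraph

variable {D : ℕ} (G : StrandedGraph D)

instance : Finite G.NontrivialVertex := Finite.of_surjective (Quot.mk G.ChordAdj) Quot.mk_surjective

instance : Finite G.Face := Finite.of_surjective (Quot.mk G.FaceAdj) Quot.mk_surjective

instance (S : Finset (Fin (D + 1))) : Finite (G.Bubble S) :=
  Finite.of_surjective (Quot.mk (G.BubbleAdj S)) Quot.mk_surjective

/-! ### Colors of vertices and faces -/

/-- A color of `S` occurs at the vertex `v`. -/
def MeetsColors (S : Finset (Fin (D + 1))) (v : G.NontrivialVertex) : Prop :=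
  ∃ p, Quot.mk G.ChordAdj p = v ∧ G.color p ∈ S

/-- The pair of colors of a face. -/
def facePair : G.Face → Sym2 (Fin (D + 1)) :=
  Quot.lift (fun x => s(G.color x.1.1, x.1.2)) <| by
    rintro x _ (rfl | rfl)
    · exact (G.chord_pair x).symm
    · simp [strand, G.edge_color]

/-- The pair of colors of a face is contained in `S`. -/
def FaceIn (S : Finset (Fin (D + 1))) (f : G.Face) : Prop := ∀ i ∈ G.facePair f, i ∈ S

theorem faceIn_mk {S : Finset (Fin (D + 1))} {x : StrandEnd G.color} :
    G.FaceIn S (Quot.mk _ x) ↔ G.color x.1.1 ∈ S ∧ x.1.2 ∈ S := by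
  simp [FaceIn, facePair]

theorem chord_mem {S : Finset (Fin (D + 1))} {x : StrandEnd G.color} (h : G.color x.1.1 ∈ S)
    (h' : x.1.2 ∈ S) : G.color (G.chord x).1.1 ∈ S ∧ (G.chord x).1.2 ∈ S := by
  have h1 : G.FaceIn S (Quot.mk _ x) := G.faceIn_mk.2 ⟨h, h'⟩
  rw [Quot.sound (r := G.FaceAdj) (Or.inl rfl : G.FaceAdj x (G.chord x))] at h1
  exact G.faceIn_mk.1 h1

/-! ### Mod 2 chains -/

/-- A mod 2 function on the vertices that meet `S`, as a function on the pre-edges. -/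
noncomputable def vertexFun (S : Finset (Fin (D + 1))) :
    ({v // G.MeetsColors S v} → ZMod 2) →ₗ[ZMod 2] (G.P → ZMod 2) :=
  (LinearMap.funLeft (ZMod 2) (ZMod 2) (Quot.mk G.ChordAdj)).comp
    (Function.ExtendByZero.linearMap (ZMod 2) (Subtype.val : {v // G.MeetsColors S v} → _))

/-- A mod 2 function on the internal faces with colors in `S`, as a function on the points. -/
noncomputable def faceFun (S : Finset (Fin (D + 1))) :
    ({f // G.FaceIn S f ∧ G.IsClosedFace f} → ZMod 2) →ₗ[ZMod 2] (StrandEnd G.color → ZMod 2) :=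
  (LinearMap.funLeft (ZMod 2) (ZMod 2) (Quot.mk G.FaceAdj)).comp
    (Function.ExtendByZero.linearMap (ZMod 2)
      (Subtype.val : {f // G.FaceIn S f ∧ G.IsClosedFace f} → _))

variable {S : Finset (Fin (D + 1))}

theorem vertexFun_apply (f : {v // G.MeetsColors S v} → ZMod 2) (v : {v // G.MeetsColors S v})
    (p : G.P) (hp : Quot.mk _ p = v.1) : G.vertexFun S f p = f v := by
  change Function.extend Subtype.val f 0 (Quot.mk _ p) = _
  rw [hp, Subtype.val_injective.extend_apply]

theorem vertexFun_chord (f : {v // G.MeetsColors S v} → ZMod 2) (x : StrandEnd G.color) :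
    G.vertexFun S f (G.chord x).1.1 = G.vertexFun S f x.1.1 := by
  change Function.extend Subtype.val f 0 (Quot.mk _ _) =
    Function.extend Subtype.val f 0 (Quot.mk _ _)
  rw [Quot.sound (r := G.ChordAdj) (a := x.1.1) ⟨x, rfl, rfl⟩]

theorem faceFun_apply (g : {f // G.FaceIn S f ∧ G.IsClosedFace f} → ZMod 2)
    (f : {f // G.FaceIn S f ∧ G.IsClosedFace f}) (x : StrandEnd G.color)
    (hx : Quot.mk _ x = f.1) : G.faceFun S g x = g f := by
  change Function.extend Subtype.val g 0 (Quot.mk _ x) = _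
  rw [hx, Subtype.val_injective.extend_apply]

theorem faceFun_chord (g : {f // G.FaceIn S f ∧ G.IsClosedFace f} → ZMod 2)
    (x : StrandEnd G.color) : G.faceFun S g (G.chord x) = G.faceFun S g x := by
  change Function.extend Subtype.val g 0 (Quot.mk _ _) =
    Function.extend Subtype.val g 0 (Quot.mk _ _)
  rw [Quot.sound (r := G.FaceAdj) (a := x) (Or.inl rfl)]

theorem faceFun_strand (g : {f // G.FaceIn S f ∧ G.IsClosedFace f} → ZMod 2)
    (x : StrandEnd G.color) : G.faceFun S g (G.strand x) = G.faceFun S g x := by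
  change Function.extend Subtype.val g 0 (Quot.mk _ _) =
    Function.extend Subtype.val g 0 (Quot.mk _ _)
  rw [Quot.sound (r := G.FaceAdj) (a := x) (Or.inr rfl)]

/-- The extension by zero ignores open faces and faces with a color outside `S`, and no closed face
passes through a half-edge. -/
theorem faceFun_eq_zero (g : {f // G.FaceIn S f ∧ G.IsClosedFace f} → ZMod 2)
    (x : StrandEnd G.color)
    (hx : ¬ (G.color x.1.1 ∈ S ∧ x.1.2 ∈ S ∧ G.edge x.1.1 ≠ x.1.1)) : G.faceFun S g x = 0 := by
  change Function.extend Subtype.val g 0 (Quot.mk _ _) = _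
  refine Function.extend_apply' _ _ _ ?_
  rintro ⟨f, hf⟩
  have h1 := f.2.1
  rw [hf] at h1
  have h2 := G.faceIn_mk.1 h1
  exact hx ⟨h2.1, h2.2, f.2.2 x hf.symm⟩

open Classical in
/-- The sum of a function on the points over the points of a pre-edge. -/
noncomputable def preEdgeSum [Fintype (StrandEnd G.color)] :
    (StrandEnd G.color → ZMod 2) →ₗ[ZMod 2] (G.P → ZMod 2) where
  toFun g p := ∑ x with x.1.1 = p, g x
  map_add' g h := by funext p; simp [Finset.sum_add_distrib]
  map_smul' c g := by funext p; simp [Finset.mul_sum]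

variable [Fintype (StrandEnd G.color)]

/-- The strands match the points of the two pre-edges of an edge and stay on the same face. Hence
the boundary at an edge can be read at either pre-edge. -/
theorem preEdgeSum_edge (g : {f // G.FaceIn S f ∧ G.IsClosedFace f} → ZMod 2) (p : G.P) :
    G.preEdgeSum (G.faceFun S g) (G.edge p) = G.preEdgeSum (G.faceFun S g) p := by
  classical
  refine Finset.sum_nbij' G.strand G.strand ?_ ?_ ?_ ?_ ?_
  · intro x hx
    simp only [Finset.mem_filter, Finset.mem_univ, true_and] at hx ⊢
    simp [strand, hx, G.edge_edge]
  · intro x hx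
    simp only [Finset.mem_filter, Finset.mem_univ, true_and] at hx ⊢
    simp [strand, hx]
  · intro x _; exact G.strand_strand x
  · intro x _; exact G.strand_strand x
  · intro x _; exact (G.faceFun_strand g x).symm

theorem preEdgeSum_eq_zero (g : {f // G.FaceIn S f ∧ G.IsClosedFace f} → ZMod 2) (p : G.P)
    (hp : ¬ (G.color p ∈ S ∧ G.edge p ≠ p)) : G.preEdgeSum (G.faceFun S g) p = 0 := by
  classical
  refine Finset.sum_eq_zero fun x hx => G.faceFun_eq_zero g x ?_
  simp only [Finset.mem_filter, Finset.mem_univ, true_and] at hx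
  subst hx
  exact fun h => hp ⟨h.1, h.2.2⟩

/-- The sum expands to one over all points. A chord joins two points with the same vertex and the
same face, so their terms cancel mod 2. -/
theorem sum_vertexFun_mul_preEdgeSum [Fintype G.P] (f : {v // G.MeetsColors S v} → ZMod 2)
    (g : {f // G.FaceIn S f ∧ G.IsClosedFace f} → ZMod 2) :
    ∑ p, G.vertexFun S f p * G.preEdgeSum (G.faceFun S g) p = 0 := by
  classical
  have h1 : ∀ p, G.vertexFun S f p * G.preEdgeSum (G.faceFun S g) p =
      ∑ x with x.1.1 = p, G.vertexFun S f x.1.1 * G.faceFun S g x := by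
    intro p
    change _ * ∑ x with x.1.1 = p, G.faceFun S g x = _
    rw [Finset.mul_sum]
    refine Finset.sum_congr rfl fun x hx => ?_
    rw [(Finset.mem_filter.1 hx).2]
  simp only [h1]
  refine (Finset.sum_fiberwise Finset.univ (fun x : StrandEnd G.color => x.1.1) _).trans ?_
  refine Finset.sum_involution (fun x _ => G.chord x) ?_ ?_ ?_ ?_
  · intro x _
    rw [vertexFun_chord, faceFun_chord]
    exact CharTwo.add_self_eq_zero _
  · intro x _ _; exact G.chord_ne x
  · intro x _; exact Finset.mem_univ _
  · intro x _; exact G.chord_chord x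

/-- If the mod 2 sum over the points of a pre-edge vanishes, the two points with colors in `S` have
equal values. -/
theorem faceFun_eq_of_preEdgeSum_eq_zero (hS : S.card = 3)
    (g : {f // G.FaceIn S f ∧ G.IsClosedFace f} → ZMod 2) {x y : StrandEnd G.color}
    (hxy : x.1.1 = y.1.1) (hc : G.color x.1.1 ∈ S) (hx : x.1.2 ∈ S) (hy : y.1.2 ∈ S)
    (h : G.preEdgeSum (G.faceFun S g) x.1.1 = 0) : G.faceFun S g x = G.faceFun S g y := by
  classical
  by_cases hne : x = y
  · rw [hne]
  have hne2 : x.1.2 ≠ y.1.2 := fun h' => hne (Subtype.ext (Prod.ext hxy h'))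
  -- With three colors in `S`, one is the color of the pre-edge and the other two label `x` and `y`;
  -- every other point of the pre-edge contributes zero.
  have hSe : S = {G.color x.1.1, x.1.2, y.1.2} := by
    refine (Finset.eq_of_subset_of_card_le ?_ ?_).symm
    · intro i hi
      simp only [Finset.mem_insert, Finset.mem_singleton] at hi
      rcases hi with rfl | rfl | rfl <;> assumption
    · rw [hS, Finset.card_eq_three.2 ⟨_, _, _, x.2.symm, ?_, hne2, rfl⟩]
      rw [hxy]; exact y.2.symm
  have h2 : ∑ z with z.1.1 = x.1.1, G.faceFun S g z = ∑ z ∈ {x, y}, G.faceFun S g z := by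
    refine (Finset.sum_subset ?_ ?_).symm
    · intro z hz
      simp only [Finset.mem_insert, Finset.mem_singleton] at hz
      rcases hz with rfl | rfl <;> simp [hxy]
    · intro z hz hz'
      simp only [Finset.mem_filter, Finset.mem_univ, true_and] at hz
      simp only [Finset.mem_insert, Finset.mem_singleton, not_or] at hz'
      refine G.faceFun_eq_zero g z fun h3 => ?_
      have h4 := h3.2.1
      rw [hSe] at h4
      simp only [Finset.mem_insert, Finset.mem_singleton] at h4
      rcases h4 with h4 | h4 | h4
      · rw [← hz] at h4; exact z.2 h4
      · exact hz'.1 (Subtype.ext (Prod.ext hz h4))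
      · exact hz'.2 (Subtype.ext (Prod.ext (hz.trans hxy) h4))
  have h3 : ∑ z with z.1.1 = x.1.1, G.faceFun S g z = 0 := h
  rw [h2, Finset.sum_pair hne] at h3
  exact CharTwo.add_eq_zero.1 h3

end StrandedGraph

/-! ### Euler inequality for three colors -/

namespace StrandedGraph

variable {D : ℕ} (G : StrandedGraph D)

/-- The Euler inequality `V + F ≤ E + 2 C` for the ribbon graph formed by the colors of a set `S` of
three colors. The edges are represented by their pre-edge of smaller rank `rk`. -/
theorem card_vertices_add_card_faces_le {S : Finset (Fin (D + 1))} (hS : S.card = 3)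
    {rk : G.P → ℕ} (hrk : Function.Injective rk) :
    Nat.card {v // G.MeetsColors S v} + Nat.card {f // G.FaceIn S f ∧ G.IsClosedFace f} ≤
      Nat.card {p // G.color p ∈ S ∧ rk p < rk (G.edge p)} + 2 * Nat.card (G.Bubble S) := by
  classical
  have := Fintype.ofFinite G.P
  have := Fintype.ofFinite {v // G.MeetsColors S v}
  have := Fintype.ofFinite {f // G.FaceIn S f ∧ G.IsClosedFace f}
  have := Fintype.ofFinite {p // G.color p ∈ S ∧ rk p < rk (G.edge p)}
  -- `a` is the mod 2 coboundary from vertices to edges, and `b` the mod 2 boundary from closed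
  -- faces to edges.
  let a : ({v // G.MeetsColors S v} → ZMod 2) →ₗ[ZMod 2]
      ({p // G.color p ∈ S ∧ rk p < rk (G.edge p)} → ZMod 2) :=
    (LinearMap.funLeft _ _ Subtype.val + LinearMap.funLeft _ _ (G.edge ∘ Subtype.val)).comp
      (G.vertexFun S)
  let b : ({f // G.FaceIn S f ∧ G.IsClosedFace f} → ZMod 2) →ₗ[ZMod 2]
      ({p // G.color p ∈ S ∧ rk p < rk (G.edge p)} → ZMod 2) :=
    (LinearMap.funLeft _ _ Subtype.val).comp (G.preEdgeSum.comp (G.faceFun S))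
  have ha : ∀ f p, a f p = G.vertexFun S f p.1 + G.vertexFun S f (G.edge p.1) := fun _ _ => rfl
  have hb : ∀ g p, b g p = G.preEdgeSum (G.faceFun S g) p.1 := fun _ _ => rfl
  have horth : ∀ f g, ∑ p, a f p * b g p = 0 := by
    intro f g
    rw [← G.sum_vertexFun_mul_preEdgeSum f g,
      sum_eq_sum_subtype_add_of_involutive G.edge_edge hrk (fun p => G.color p ∈ S)
        (fun p hp => by rwa [G.edge_color])
        (fun p => G.vertexFun S f p * G.preEdgeSum (G.faceFun S g) p)]
    · refine Finset.sum_congr rfl fun p _ => ?_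
      rw [ha, hb, preEdgeSum_edge, add_mul]
    · intro p hp
      rw [G.preEdgeSum_eq_zero g p (fun h => h.2 hp), mul_zero]
    · intro p hp
      rw [G.preEdgeSum_eq_zero g p (fun h => hp h.1), mul_zero]
  -- Edges are recorded at their pre-edge of smaller rank, which is either `p` or `G.edge p`.
  have hcases : ∀ p, G.color p ∈ S → G.edge p ≠ p →
      (rk p < rk (G.edge p)) ∨ (rk (G.edge p) < rk (G.edge (G.edge p))) := by
    intro p _ hp
    rw [G.edge_edge]
    exact lt_or_gt_of_ne fun h => hp (hrk h).symm
  -- A vertex function with zero coboundary agrees across edges, and it agrees across chords by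
  -- construction, so it is constant on bubbles.
  have hka : Module.finrank (ZMod 2) (LinearMap.ker a) ≤ Nat.card (G.Bubble S) := by
    refine finrank_le_card_quot (G.BubbleAdj S)
      ((LinearMap.funLeft (ZMod 2) (ZMod 2)
        (Subtype.val : {p : G.P // G.color p ∈ S} → G.P)).comp
          ((G.vertexFun S).comp (LinearMap.ker a).subtype)) ?_ ?_
    · rw [← LinearMap.ker_eq_bot, LinearMap.ker_eq_bot']
      rintro ⟨f, hf⟩ h
      apply Subtype.ext
      funext v
      obtain ⟨p, hp, hpS⟩ := v.2
      have h1 := congrFun h ⟨p, hpS⟩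
      exact (G.vertexFun_apply f v p hp).symm.trans h1
    · rintro ⟨f, hf⟩ p q (h | ⟨x, -, hx, hx'⟩)
      · change G.vertexFun S f p.1 = G.vertexFun S f q.1
        rw [h]
        by_cases he : G.edge p.1 = p.1
        · rw [he]
        rcases hcases p.1 p.2 he with h1 | h1
        · have h2 := congrFun hf ⟨p.1, p.2, h1⟩
          rw [ha] at h2
          exact CharTwo.add_eq_zero.1 h2
        · have h2 := congrFun hf ⟨G.edge p.1, by rw [G.edge_color]; exact p.2, h1⟩
          rw [ha] at h2
          have h3 := CharTwo.add_eq_zero.1 h2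
          simp only [G.edge_edge] at h3
          exact h3.symm
      · change G.vertexFun S f p.1 = G.vertexFun S f q.1
        rw [← hx, ← hx', vertexFun_chord]
  have hpt : ∀ p : {p : G.P // G.color p ∈ S}, ∃ x : StrandEnd G.color, x.1.1 = p.1 ∧ x.1.2 ∈ S := by
    intro p
    obtain ⟨j, hj, hne⟩ := Finset.exists_mem_ne (by omega : 1 < S.card) (G.color p.1)
    exact ⟨⟨(p.1, j), hne⟩, rfl, hj⟩
  choose pt hpt1 hpt2 using hpt
  -- For a face function with zero boundary, the two points of a pre-edge inside `S` have equal
  -- values. The chosen point `pt p` thus stands for the whole pre-edge, and its value propagates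
  -- along strands and chords through the bubble.
  have hkb : Module.finrank (ZMod 2) (LinearMap.ker b) ≤ Nat.card (G.Bubble S) := by
    have hzero : ∀ g, b g = 0 → ∀ p, G.color p ∈ S → G.preEdgeSum (G.faceFun S g) p = 0 := by
      intro g hg p hp
      by_cases he : G.edge p = p
      · exact G.preEdgeSum_eq_zero g p fun h => h.2 he
      rcases hcases p hp he with h1 | h1
      · exact congrFun hg ⟨p, hp, h1⟩
      · rw [← preEdgeSum_edge]
        exact congrFun hg ⟨G.edge p, by rwa [G.edge_color], h1⟩
    have hval : ∀ g, b g = 0 → ∀ (p : {p : G.P // G.color p ∈ S}) (x : StrandEnd G.color),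
        x.1.1 = p.1 → x.1.2 ∈ S → G.faceFun S g (pt p) = G.faceFun S g x := by
      intro g hg p x hx hxS
      have hcol : G.color (pt p).1.1 ∈ S := by rw [hpt1]; exact p.2
      exact G.faceFun_eq_of_preEdgeSum_eq_zero hS g ((hpt1 p).trans hx.symm) hcol (hpt2 p) hxS
        (hzero g hg _ hcol)
    refine finrank_le_card_quot (G.BubbleAdj S)
      ((LinearMap.funLeft (ZMod 2) (ZMod 2) pt).comp
          ((G.faceFun S).comp (LinearMap.ker b).subtype)) ?_ ?_
    · rw [← LinearMap.ker_eq_bot, LinearMap.ker_eq_bot']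
      rintro ⟨g, hg⟩ h
      apply Subtype.ext
      funext f
      obtain ⟨x, hx⟩ := Quot.exists_rep f.1
      have h1 := f.2.1
      rw [← hx] at h1
      have h2 := G.faceIn_mk.1 h1
      have h3 := congrFun h ⟨x.1.1, h2.1⟩
      exact ((G.faceFun_apply g f x hx).symm.trans (hval g hg ⟨x.1.1, h2.1⟩ x rfl h2.2).symm).trans
        h3
    · rintro ⟨g, hg⟩ p q (h | ⟨x, hxS, hx, hx'⟩)
      · change G.faceFun S g (pt p) = G.faceFun S g (pt q)
        rw [hval g hg q (G.strand (pt p)) (by rw [h, ← hpt1]; rfl) (hpt2 p), faceFun_strand]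
      · change G.faceFun S g (pt p) = G.faceFun S g (pt q)
        have hc : G.color x.1.1 ∈ S := by rw [hx]; exact p.2
        rw [hval g hg p x hx hxS, hval g hg q _ hx' (G.chord_mem hc hxS).2, faceFun_chord]
  have h1 := finrank_range_add_finrank_range_le_card a b horth
  have h2 := a.finrank_range_add_finrank_ker
  have h3 := b.finrank_range_add_finrank_ker
  rw [Module.finrank_fintype_fun_eq_card] at h2 h3
  simp only [Nat.card_eq_fintype_card (α := {v // G.MeetsColors S v}),
    Nat.card_eq_fintype_card (α := {f // G.FaceIn S f ∧ G.IsClosedFace f}),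
    Nat.card_eq_fintype_card (α := {p // G.color p ∈ S ∧ rk p < rk (G.edge p)})]
  omega

/-! ### Counting edges and nested bubbles -/

/-- Each edge has at most one pre-edge of smaller rank. -/
theorem card_le_numEdges (rk : G.P → ℕ) :
    Nat.card {p // rk p < rk (G.edge p)} ≤ G.numEdges := by
  rw [numEdges, ← Nat.card_coe_set_eq]
  refine Nat.card_le_card_of_injective
    (fun p => ⟨s(p.1, G.edge p.1), p.1, fun h => ?_, rfl⟩) ?_
  · have := p.2
    rw [h] at this
    exact lt_irrefl _ this
  · intro p q h
    have h1 := congrArg Subtype.val h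
    simp only [Sym2.eq_iff] at h1
    rcases h1 with h1 | ⟨h1, h2⟩
    · exact Subtype.ext h1.1
    · have hp := p.2
      have hq := q.2
      rw [h2, h1] at hp
      exact absurd hp (lt_asymm hq)

/-- The bubble with more colors that contains a given bubble. -/
def Bubble.map {S S' : Finset (Fin (D + 1))} (h : S ⊆ S') : G.Bubble S → G.Bubble S' :=
  Quot.map (fun p => ⟨p.1, h p.2⟩) <| by
    rintro p q (h1 | ⟨x, hx, h1⟩)
    · exact Or.inl h1
    · exact Or.inr ⟨x, h hx, h1⟩

/-- A color that occurs in a bubble. -/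
noncomputable def Bubble.repColor {S : Finset (Fin (D + 1))} (b : G.Bubble S) : Fin (D + 1) :=
  G.color (Quot.out b).1

theorem Bubble.repColor_mem {S : Finset (Fin (D + 1))} (b : G.Bubble S) :
    Bubble.repColor G b ∈ S := (Quot.out b).2

/-- A larger bubble is recovered from the smaller bubble of its representative pre-edge, because the
smaller one lies inside it. -/
theorem card_bubble_repColor_le {S S' : Finset (Fin (D + 1))} (h : S ⊆ S') :
    Nat.card {b : G.Bubble S' // Bubble.repColor G b ∈ S} ≤ Nat.card (G.Bubble S) := by
  refine Nat.card_le_card_of_injective (fun b => Quot.mk _ ⟨(Quot.out b.1).1, b.2⟩) ?_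
  intro b b' hb
  have h1 := congrArg (Bubble.map G h) hb
  apply Subtype.ext
  rw [← Quot.out_eq b.1, ← Quot.out_eq b'.1]
  exact h1

/-- Every bubble with `k + 1` colors contains at least `k` bubbles with `k` of these colors. -/
theorem mul_card_bubble_le {k : ℕ} {S' : Finset (Fin (D + 1))} (hS' : S'.card = k + 1) :
    k * Nat.card (G.Bubble S') ≤ ∑ S ∈ S'.powersetCard k, Nat.card (G.Bubble S) := by
  classical
  have := Fintype.ofFinite (G.Bubble S')
  refine le_trans ?_ (Finset.sum_le_sum fun S hS =>
    G.card_bubble_repColor_le (Finset.mem_powersetCard.1 hS).1)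
  refine mul_card_le_sum_card_subtype _ _ _ fun b => ?_
  have hc := Bubble.repColor_mem G b
  generalize Bubble.repColor G b = i at hc
  -- Let `i` be the color of the representative. Erasing any of the `k` other colors from `S'` gives
  -- `k` distinct sets that still contain `i`.
  have hinj : Set.InjOn (fun j => S'.erase j) (S'.erase i) := by
    intro j hj j' hj' h
    by_contra hne
    have h1 : j ∈ S'.erase j' := Finset.mem_erase.2 ⟨hne, Finset.mem_of_mem_erase hj⟩
    have h2 : S'.erase j = S'.erase j' := h
    rw [← h2] at h1
    exact Finset.notMem_erase _ _ h1
  have h1 := Finset.card_image_of_injOn hinj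
  rw [Finset.card_erase_of_mem hc, hS', Nat.add_sub_cancel] at h1
  refine h1.symm.le.trans (Finset.card_le_card fun S hS => ?_)
  obtain ⟨j, hj, rfl⟩ := Finset.mem_image.1 hS
  have hj' := Finset.mem_erase.1 hj
  rw [Finset.mem_filter, Finset.mem_powersetCard]
  exact ⟨⟨Finset.erase_subset _ _, by rw [Finset.card_erase_of_mem hj'.2, hS']; rfl⟩,
    Finset.mem_erase.2 ⟨hj'.1.symm, hc⟩⟩

end StrandedGraph

/-! ### Incidences among subsets of five colors -/

theorem card_powersetCard_three_filter_mem (i : Fin 5) :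
    ((Finset.univ.powersetCard 3).filter fun S => i ∈ S).card = 6 := by
  revert i; decide

theorem card_powersetCard_three_filter_mem_mem {i j : Fin 5} (h : i ≠ j) :
    ((Finset.univ.powersetCard 3).filter fun S => i ∈ S ∧ j ∈ S).card = 3 := by
  revert i j; decide

theorem card_powersetCard_four_filter_superset {S : Finset (Fin 5)}
    (hS : S ∈ (Finset.univ : Finset (Fin 5)).powersetCard 3) :
    ((Finset.univ.powersetCard 4).filter fun S' => S ⊆ S').card = 2 := by
  revert S; decide

/-! ### Summation over the sets of colors -/

namespace StrandedGraph

variable (G : StrandedGraph 4)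

theorem three_mul_numBubbles_four_le : 3 * G.numBubbles 4 ≤ 2 * G.numBubbles 3 := by
  classical
  unfold numBubbles
  calc 3 * ∑ S' ∈ (Finset.univ : Finset (Fin 5)).powersetCard 4, Nat.card (G.Bubble S')
      ≤ ∑ S' ∈ (Finset.univ : Finset (Fin 5)).powersetCard 4,
          ∑ S ∈ S'.powersetCard 3, Nat.card (G.Bubble S) := by
        rw [Finset.mul_sum]
        exact Finset.sum_le_sum fun S' hS' =>
          G.mul_card_bubble_le (Finset.mem_powersetCard.1 hS').2
    -- Exchange of the sums: each triple is now counted once for every quadruple that contains it.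
    _ = ∑ S ∈ (Finset.univ : Finset (Fin 5)).powersetCard 3,
          ∑ S' ∈ (Finset.univ.powersetCard 4).filter (fun S' => S ⊆ S'), Nat.card (G.Bubble S) := by
        refine Finset.sum_comm' fun S' S => ?_
        simp only [Finset.mem_powersetCard, Finset.mem_filter, Finset.subset_univ, true_and]
        tauto
    _ = 2 * ∑ S ∈ (Finset.univ : Finset (Fin 5)).powersetCard 3, Nat.card (G.Bubble S) := by
        rw [Finset.mul_sum]
        refine Finset.sum_congr rfl fun S hS => ?_
        rw [Finset.sum_const, card_powersetCard_four_filter_superset hS, smul_eq_mul]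

theorem numBubbles_four_pos (hV : Nonempty G.NontrivialVertex) : 0 < G.numBubbles 4 := by
  obtain ⟨v⟩ := hV
  obtain ⟨p, -⟩ := Quot.exists_rep v
  have h : ∃ S ∈ (Finset.univ : Finset (Fin 5)).powersetCard 4, G.color p ∈ S := by
    generalize G.color p = i
    revert i; decide
  obtain ⟨S, hS, hp⟩ := h
  refine Finset.sum_pos' (fun _ _ => Nat.zero_le _) ⟨S, hS, ?_⟩
  have : Nonempty (G.Bubble S) := ⟨Quot.mk _ ⟨p, hp⟩⟩
  exact Nat.card_pos

/-- The sum of the Euler inequalities of the ribbon graphs for all the sets of three colors. -/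
theorem six_mul_card_vertices_add_three_mul_card_faces_le :
    6 * Nat.card G.NontrivialVertex + 3 * Nat.card {f : G.Face // G.IsClosedFace f} ≤
      6 * G.numEdges + 2 * G.numBubbles 3 := by
  classical
  have := Fintype.ofFinite G.P
  have := Fintype.ofFinite G.NontrivialVertex
  have := Fintype.ofFinite G.Face
  have := Fintype.ofFinite {f : G.Face // G.IsClosedFace f}
  obtain ⟨rk, hrk⟩ := exists_injective_nat G.P
  have := Fintype.ofFinite {p // rk p < rk (G.edge p)}
  have h0 : ∑ S ∈ (Finset.univ : Finset (Fin 5)).powersetCard 3,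
        (Nat.card {v // G.MeetsColors S v} + Nat.card {f // G.FaceIn S f ∧ G.IsClosedFace f}) ≤
      ∑ S ∈ (Finset.univ : Finset (Fin 5)).powersetCard 3,
        (Nat.card {p // G.color p ∈ S ∧ rk p < rk (G.edge p)} + 2 * Nat.card (G.Bubble S)) :=
    Finset.sum_le_sum fun S hS =>
      G.card_vertices_add_card_faces_le (Finset.mem_powersetCard.1 hS).2 hrk
  rw [Finset.sum_add_distrib, Finset.sum_add_distrib, ← Finset.mul_sum] at h0
  -- Already the color of a single pre-edge makes the vertex meet six triples; further colors can
  -- only add more.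
  have hV : 6 * Nat.card G.NontrivialVertex ≤
      ∑ S ∈ (Finset.univ : Finset (Fin 5)).powersetCard 3, Nat.card {v // G.MeetsColors S v} := by
    refine mul_card_le_sum_card_subtype _ _ _ fun v => ?_
    obtain ⟨p, hp⟩ := Quot.exists_rep v
    exact (card_powersetCard_three_filter_mem (G.color p)).ge.trans
      (Finset.card_le_card (Finset.monotone_filter_right _ fun S _ hS => ⟨p, hp, hS⟩))
  have hF : 3 * Nat.card {f : G.Face // G.IsClosedFace f} ≤
      ∑ S ∈ (Finset.univ : Finset (Fin 5)).powersetCard 3,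
        Nat.card {f // G.FaceIn S f ∧ G.IsClosedFace f} := by
    have h1 : ∀ S, Nat.card {f // G.FaceIn S f ∧ G.IsClosedFace f} =
        Nat.card {f : {f : G.Face // G.IsClosedFace f} // G.FaceIn S f.1} := fun S =>
      Nat.card_congr (((Equiv.subtypeSubtypeEquivSubtypeInter G.IsClosedFace (G.FaceIn S)).trans
        (Equiv.subtypeEquivRight fun f => and_comm)).symm)
    simp only [h1]
    refine mul_card_le_sum_card_subtype _
      (fun S (f : {f : G.Face // G.IsClosedFace f}) => G.FaceIn S f.1) _ fun f => ?_
    obtain ⟨x, hx⟩ := Quot.exists_rep f.1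
    refine (card_powersetCard_three_filter_mem_mem x.2.symm).ge.trans
      (Finset.card_le_card (Finset.monotone_filter_right _ fun S _ hS => ?_))
    rw [← hx]
    exact G.faceIn_mk.2 hS
  have hE : ∑ S ∈ (Finset.univ : Finset (Fin 5)).powersetCard 3,
      Nat.card {p // G.color p ∈ S ∧ rk p < rk (G.edge p)} ≤ 6 * G.numEdges := by
    have h1 : ∀ S : Finset (Fin 5), Nat.card {p // G.color p ∈ S ∧ rk p < rk (G.edge p)} =
        Nat.card {p : {p // rk p < rk (G.edge p)} // G.color p.1 ∈ S} := fun S =>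
      Nat.card_congr (((Equiv.subtypeSubtypeEquivSubtypeInter (fun p => rk p < rk (G.edge p))
        (fun p => G.color p ∈ S)).trans (Equiv.subtypeEquivRight fun f => and_comm)).symm)
    simp only [h1]
    rw [sum_card_subtype_eq_sum_card_filter]
    simp only [card_powersetCard_three_filter_mem]
    rw [Finset.sum_const, smul_eq_mul, mul_comm, Finset.card_univ, ← Nat.card_eq_fintype_card]
    exact Nat.mul_le_mul_left 6 (G.card_le_numEdges rk)
  change _ ≤ _ + 2 * ∑ S ∈ (Finset.univ : Finset (Fin 5)).powersetCard 3, _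
  omega

end StrandedGraph

/-! ### Proof of the proposition -/

theorem proposition3p4 (G : StrandedGraph 4) (hG : G.IsWColoredRepresentative)
    (hV : Nonempty G.NontrivialVertex) :
    (∃ α₃ α₄ : ℚ, 0 < α₃ ∧ 0 < α₄ ∧ ∃ m : ℤ, m < 0 ∧ G.gamma4 α₃ α₄ = m) ∧
      (G.discs = 0 → ∀ α₃ α₄ : ℚ, 0 < α₃ → 0 < α₄ →
        (∃ z : ℤ, -2 * (1 + α₃) * G.numBubbles 3 + (3 * α₃ - α₄) * G.numBubbles 4 = z) →
        ∃ m : ℤ, m < 0 ∧ G.gamma4 α₃ α₄ = m) := by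
  have hB := G.numBubbles_four_pos hV
  have hB34 := G.three_mul_numBubbles_four_le
  refine ⟨?_, ?_⟩
  · set N : ℤ := 6 * G.numVertices + 3 * G.numInternalFaces + 1 with hN
    refine ⟨1, N, one_pos, by exact_mod_cast (by positivity : 0 < N),
      6 * ((G.numVertices : ℤ) - G.numEdges) + 3 * G.numInternalFaces
        - 4 * G.numBubbles 3 + (3 - N) * G.numBubbles 4, ?_, ?_⟩
    · have h1 : N ≤ N * G.numBubbles 4 :=
        le_mul_of_one_le_right (by positivity) (by exact_mod_cast hB)
      rw [sub_mul]
      omega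
    · simp only [StrandedGraph.gamma4]
      push_cast
      ring
  · rintro hd α₃ α₄ h3 h4 ⟨z, hz⟩
    have hEuler := G.six_mul_card_vertices_add_three_mul_card_faces_le
    have hv : G.numVertices = Nat.card G.NontrivialVertex := by
      rw [StrandedGraph.numVertices, hd, add_zero]
    have hf : G.numInternalFaces = Nat.card {f : G.Face // G.IsClosedFace f} := by
      rw [StrandedGraph.numInternalFaces, hd, add_zero]
    rw [← hv, ← hf] at hEuler
    have hm : G.gamma4 α₃ α₄ =
        ((6 * ((G.numVertices : ℤ) - G.numEdges) + 3 * G.numInternalFaces + z : ℤ) : ℚ) := by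
      push_cast
      rw [← hz, StrandedGraph.gamma4]
      ring
    refine ⟨_, ?_, hm⟩
    rw [← Int.cast_lt (R := ℚ), ← hm, Int.cast_zero, StrandedGraph.gamma4]
    -- The total is at most $-\alpha_4B^4$: `e1` bounds the part free of $\alpha_3,\alpha_4$, `e4`
    -- the multiple of $\alpha_3$, and `e5` gives strictness.
    have e1 : (6 * G.numVertices + 3 * G.numInternalFaces : ℚ) ≤
        6 * G.numEdges + 2 * G.numBubbles 3 := by exact_mod_cast hEuler
    have e2 : (3 * G.numBubbles 4 : ℚ) ≤ 2 * G.numBubbles 3 := by exact_mod_cast hB34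
    have e3 : (0 : ℚ) < G.numBubbles 4 := by exact_mod_cast hB
    have e4 := mul_le_mul_of_nonneg_left e2 h3.le
    have e5 := mul_pos h4 e3
    linarith
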